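/- Let $\mathbb{F}$ be a field and let $G$ be a torsion-free group, that is, a group in which no non-identity element has finite order. For $\alpha=\sum_{x\in G}a_x x$ in the group algebra $\mathbb{F}[G]$, write $\mathrm{supp}(\alpha)=\{x\in G : a_x\neq 0\}$. If $\alpha,\beta\in\mathbb{F}[G]$ are non-zero, $|\mathrm{supp}(\alpha)|=3$ and $\alpha\beta=0$, then $|\mathrm{supp}(\beta)|\geq 10$. -/

import Mathlib

/-! If `α * β = 0`, every product `s i * b` of support elements must cancel against some `s j * b'`
with `j ≠ i`. So each product at a known element of `B` forces one of two explicit elements into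
`B`. `card_le_of_search` follows both alternatives and counts, provided the elements met can be told
apart.

These elements are words in the quotients `(s j)⁻¹ * s i`. If no cyclically reduced word of one to
four pairs is trivial, the search reaches ten elements (`search_pairs`). Otherwise one of 17
relations holds, up to renaming, rotation and inversion (`classified_of_short`). Put `x = (s 0)⁻¹ *
s 1` and `y = (s 0)⁻¹ * s 2`. Fifteen of the relations give torsion, commuting `x` and `y`, or `t *
u * t⁻¹ = u ^ m` with `m ≠ 1`; all are impossible (`not_commute`, `not_conj_eq_zpow`).

The other two are `x³ = y²` and `yxy = x²`, the latter being `x³ = (xy)²`. Then the group is a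
torsion-free nonabelian quotient of the braid group on three strands. Short words are still
nontrivial there (`commute_of_braid_word`), and a search with words adapted to that group again
finds ten elements. -/

/-- A torsion-free group `G` with a triple `s` of distinct elements and a nonempty finite set `B`
such that no product `s i * b` with `b ∈ B` is unique, and such that the quotients
`(s i)⁻¹ * s j` generate `G`. -/
structure NoUniqueProduct {G : Type*} [Group G] (s : Fin 3 → G) (B : Finset G) : Prop where
  eq_one_of_pow : ∀ (g : G) (n : ℕ), n ≠ 0 → g ^ n = 1 → g = 1
  injective : Function.Injective s
  nonempty : B.Nonempty
  exists_eq : ∀ b ∈ B, ∀ i, ∃ j, j ≠ i ∧ ∃ b' ∈ B, s i * b = s j * b'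
  closure_eq_top : Subgroup.closure {g | ∃ i j, g = (s i)⁻¹ * s j} = ⊤

/-! ### A search for many distinct elements -/

section Search

variable {E : Type*}

/-- The two indices in `Fin 3` other than the given one. -/
def others : Fin 3 → Fin 3 × Fin 3
  | 0 => (1, 2)
  | 1 => (0, 2)
  | 2 => (0, 1)

/-- The two elements of which one has to belong to `B` because of the product `s i * b`. -/
def neighbours (mv : Fin 3 → Fin 3 → E → E) (p : E × Fin 3) : E × E :=
  (mv p.2 (others p.2).1 p.1, mv p.2 (others p.2).2 p.1)

/-- The products at `e` other than the one with index `j`. -/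
def ports (e : E) (j : Fin 3) : List (E × Fin 3) :=
  [(e, (others j).1), (e, (others j).2)]

/-- Starting from a list `L` of pairwise distinct elements of `B` and a queue of products at
elements of `B`, a search whose success guarantees that `B` has `need` further elements. -/
def search (mv : Fin 3 → Fin 3 → E → E) (ne : E → E → Bool) :
    ℕ → ℕ → List E → List (E × Fin 3) → Bool
  | _, 0, _, _ => true
  | 0, _ + 1, _, _ => false
  | _ + 1, _ + 1, _, [] => false
  | fuel + 1, need + 1, L, p :: Q =>
    match neighbours mv p with
    | (e₁, e₂) =>
      if L.all (ne e₁) && L.all (ne e₂) then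
        search mv ne fuel need (e₁ :: L) (Q ++ ports e₁ (others p.2).1) &&
          search mv ne fuel need (e₂ :: L) (Q ++ ports e₂ (others p.2).2)
      else search mv ne fuel (need + 1) L Q

/-- A product is used only if both candidates are certified new, so either branch enlarges `L`;
otherwise it is dropped. An element reached through index `j` has its `j`-th product equal to the
one just used, so only its two other products are queued. -/
theorem card_le_of_search {G : Type*} [Group G] {s : Fin 3 → G} {B : Finset G}
    (h : NoUniqueProduct s B) (mv : Fin 3 → Fin 3 → E → E) (ne : E → E → Bool) (val : E → G)
    (hmv : ∀ i j e, val (mv i j e) = (s j)⁻¹ * s i * val e)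
    (hne : ∀ e f, ne e f = true → val e ≠ val f) (b : G) :
    ∀ (fuel need : ℕ) (L : List E) (Q : List (E × Fin 3)),
      (L.map val).Nodup → (∀ e ∈ L, val e * b ∈ B) → (∀ p ∈ Q, val p.1 * b ∈ B) →
      search mv ne fuel need L Q = true → L.length + need ≤ B.card := by
  classical
  have base : ∀ L : List E, (L.map val).Nodup → (∀ e ∈ L, val e * b ∈ B) →
      L.length ≤ B.card := by
    intro L hL hB
    have h1 : ((L.map val).map (· * b)).Nodup := hL.map (mul_left_injective b)
    have h2 : ((L.map val).map (· * b)).toFinset ⊆ B := by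
      intro g hg
      simp only [List.mem_toFinset, List.mem_map] at hg
      obtain ⟨_, ⟨e, he, rfl⟩, rfl⟩ := hg
      exact hB e he
    have h3 := Finset.card_le_card h2
    rwa [List.toFinset_card_of_nodup h1, List.length_map, List.length_map] at h3
  have hoth : ∀ i j : Fin 3, j ≠ i → j = (others i).1 ∨ j = (others i).2 := by decide
  intro fuel
  induction fuel with
  | zero =>
    intro need L Q hL hB _ hs
    cases need with
    | zero => exact base L hL hB
    | succ n => simp [search] at hs
  | succ fuel ih =>
    intro need L Q hL hB hQ hs
    cases need with
    | zero => exact base L hL hB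
    | succ need =>
      cases Q with
      | nil => simp [search] at hs
      | cons p Q =>
        have hQ' : ∀ q ∈ Q, val q.1 * b ∈ B := fun q hq => hQ q (List.mem_cons_of_mem _ hq)
        change (if (L.all (ne (mv p.2 (others p.2).1 p.1)) &&
            L.all (ne (mv p.2 (others p.2).2 p.1))) = true then _ else _) = true at hs
        split_ifs at hs with hc
        · rw [Bool.and_eq_true] at hc hs
          obtain ⟨j, hj, b', hb', e⟩ := h.exists_eq _ (hQ p List.mem_cons_self) p.2
          have key : ∀ j : Fin 3, val (mv p.2 j p.1) * b ∈ B →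
              L.all (ne (mv p.2 j p.1)) = true →
              search mv ne fuel need (mv p.2 j p.1 :: L) (Q ++ ports (mv p.2 j p.1) j) = true →
              L.length + (need + 1) ≤ B.card := by
            intro j hjB hjL hjs
            have := ih need (mv p.2 j p.1 :: L) (Q ++ ports (mv p.2 j p.1) j) ?_ ?_ ?_ hjs
            · simpa [add_assoc, add_comm, add_left_comm] using this
            · rw [List.map_cons, List.nodup_cons]
              refine ⟨?_, hL⟩
              intro hm
              obtain ⟨f, hf, hfe⟩ := List.mem_map.1 hm
              exact hne _ _ (List.all_eq_true.1 hjL f hf) hfe.symm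
            · intro e he
              rcases List.mem_cons.1 he with rfl | he
              · exact hjB
              · exact hB e he
            · intro q hq
              rcases List.mem_append.1 hq with hq | hq
              · exact hQ' q hq
              · simp only [ports, List.mem_cons, List.not_mem_nil, or_false] at hq
                rcases hq with rfl | rfl <;> exact hjB
          have hmem : val (mv p.2 j p.1) * b ∈ B := by
            rw [hmv]
            have : (s j)⁻¹ * s p.2 * val p.1 * b = b' := by
              rw [mul_assoc, mul_assoc, e, inv_mul_cancel_left]
            rwa [this]
          rcases hoth _ _ hj with rfl | rfl
          · exact key _ hmem hc.1 hs.1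
          · exact key _ hmem hc.2 hs.2
        · exact ih (need + 1) L Q hL hB hQ' hs

theorem card_le_of_search_one {G : Type*} [Group G] {s : Fin 3 → G} {B : Finset G}
    (h : NoUniqueProduct s B) (mv : Fin 3 → Fin 3 → E → E) (ne : E → E → Bool) (val : E → G)
    (hmv : ∀ i j e, val (mv i j e) = (s j)⁻¹ * s i * val e)
    (hne : ∀ e f, ne e f = true → val e ≠ val f) (o : E) (ho : val o = 1) (fuel need : ℕ)
    (hs : search mv ne fuel need [o] [(o, 0), (o, 1), (o, 2)] = true) :
    need + 1 ≤ B.card := by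
  obtain ⟨b, hb⟩ := h.nonempty
  have := card_le_of_search h mv ne val hmv hne b fuel need [o] _ (by simp) (by simpa [ho])
    (by simpa [ho]) hs
  simpa [add_comm] using this

end Search

/-! ### Words in a central extension of the modular group -/

/-- The letters `u`, `u⁻¹` and `v`. -/
inductive Letter
  | u | uInv | v

namespace Letter

/-- Left multiplication of `z ^ k * w` by a letter, where `z = u ^ 3 = v ^ 2` is central. -/
def push : Letter → ℤ × List Letter → ℤ × List Letter
  | u, (k, u :: w) => (k + 1, uInv :: w)
  | u, (k, uInv :: w) => (k, w)
  | uInv, (k, u :: w) => (k, w)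
  | uInv, (k, uInv :: w) => (k - 1, u :: w)
  | v, (k, v :: w) => (k + 1, w)
  | l, (k, w) => (k, l :: w)

/-- Left multiplication by the inverse of a letter. -/
def pushInv : Letter → ℤ × List Letter → ℤ × List Letter
  | u, e => push uInv e
  | uInv, e => push u e
  | v, (k, w) => push v (k - 1, w)

/-- Left multiplication by a word. -/
def pushWord : List Letter → ℤ × List Letter → ℤ × List Letter
  | [], e => e
  | l :: w, e => push l (pushWord w e)

/-- Left multiplication by the inverse of a word. -/
def pushWordInv : List Letter → ℤ × List Letter → ℤ × List Letter
  | [], e => e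
  | l :: w, e => pushWordInv w (pushInv l e)

/-- Splits off the last letter of a nonempty word. -/
def splitLast : Letter → List Letter → List Letter × Letter
  | l, [] => ([], l)
  | l, m :: w =>
    match splitLast m w with
    | (i, t) => (l :: i, t)

/-- Whether two letters cancel or combine. -/
def alike : Letter → Letter → Bool
  | v, v => true
  | v, _ => false
  | _, v => false
  | _, _ => true

/-- Cyclic reduction. -/
def cyclicReduce : ℕ → ℤ × List Letter → ℤ × List Letter
  | 0, e => e
  | _ + 1, (k, []) => (k, [])
  | _ + 1, (k, [l]) => (k, [l])
  | n + 1, (k, l :: m :: w) =>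
    match splitLast m w with
    | (i, t) => if alike l t then cyclicReduce n (push t (k, l :: i)) else (k, l :: m :: w)

/-- Reads an alternating word as a product of factors `u * v` (true) and `u⁻¹ * v` (false). -/
def syllables : List Letter → Option (List Bool)
  | [] => some []
  | u :: v :: w => (syllables w).map (true :: ·)
  | uInv :: v :: w => (syllables w).map (false :: ·)
  | _ => none

/-- Whether `z ^ k * w` is recognized as nontrivial. -/
def nontrivial : ℤ × List Letter → Bool
  | (k, []) => k != 0
  | (_, [_]) => true
  | (_, v :: w) =>
    match syllables (w ++ [v]) with
    | some (_ :: c) => c.length ≤ 3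
    | _ => false
  | (_, w) =>
    match syllables w with
    | some (_ :: c) => c.length ≤ 3
    | _ => false

/-- A sufficient criterion for `z ^ k * w` and `z ^ m * w'` to differ. -/
def ne (e f : ℤ × List Letter) : Bool :=
  nontrivial (cyclicReduce 20 (pushWordInv f.2 (e.1 - f.1, e.2)))

/-- Left multiplication by `(σ j)⁻¹ * σ i`. -/
def move (σ : Fin 3 → List Letter) (i j : Fin 3) (e : ℤ × List Letter) : ℤ × List Letter :=
  pushWordInv (σ j) (pushWord (σ i) e)

/-- The triple `1, u, v`. -/
def tripleA : Fin 3 → List Letter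
  | 0 => []
  | 1 => [u]
  | 2 => [v]

/-- The triple `1, u, u⁻¹ * v`. -/
def tripleB : Fin 3 → List Letter
  | 0 => []
  | 1 => [u]
  | 2 => [uInv, v]

/-- Nine elements are needed beyond the starting one; 40 bounds the products examined along a
branch. -/
theorem search_tripleA : search (move tripleA) ne 40 9 [(0, [])]
    [((0, []), 0), ((0, []), 1), ((0, []), 2)] = true := by
  decide +kernel

theorem search_tripleB : search (move tripleB) ne 40 9 [(0, [])]
    [((0, []), 0), ((0, []), 1), ((0, []), 2)] = true := by
  decide +kernel

end Letter

/-! ### Cases without unique products that are impossible -/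

namespace NoUniqueProduct

variable {G : Type*} [Group G] {s : Fin 3 → G} {B : Finset G}

theorem eq_one_of_zpow (h : NoUniqueProduct s B) {g : G} {n : ℤ} (hn : n ≠ 0) (hg : g ^ n = 1) :
    g = 1 := by
  refine h.eq_one_of_pow g n.natAbs (Int.natAbs_ne_zero.2 hn) ?_
  rcases Int.natAbs_eq n with e | e
  · rwa [e, zpow_natCast] at hg
  · rwa [e, zpow_neg, inv_eq_one, zpow_natCast] at hg

theorem perm (h : NoUniqueProduct s B) (p : Equiv.Perm (Fin 3)) : NoUniqueProduct (s ∘ p) B where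
  eq_one_of_pow := h.eq_one_of_pow
  injective := h.injective.comp p.injective
  nonempty := h.nonempty
  exists_eq b hb i := by
    obtain ⟨j, hj, b', hb', e⟩ := h.exists_eq b hb (p i)
    exact ⟨p.symm j, fun hij => hj (by rw [← hij, Equiv.apply_symm_apply]), b', hb', by simpa⟩
  closure_eq_top := by
    rw [← h.closure_eq_top]
    congr 1
    ext g
    constructor
    · rintro ⟨i, j, rfl⟩
      exact ⟨p i, p j, rfl⟩
    · rintro ⟨i, j, rfl⟩
      exact ⟨p.symm i, p.symm j, by simp⟩

theorem eq_top_of_mem (h : NoUniqueProduct s B) {H : Subgroup G}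
    (h₁ : (s 0)⁻¹ * s 1 ∈ H) (h₂ : (s 0)⁻¹ * s 2 ∈ H) : H = ⊤ := by
  rw [eq_top_iff, ← h.closure_eq_top, Subgroup.closure_le]
  have h0 : ∀ i, (s 0)⁻¹ * s i ∈ H := by
    intro i
    fin_cases i
    · simp
    · exact h₁
    · exact h₂
  rintro g ⟨i, j, rfl⟩
  have := H.mul_mem (H.inv_mem (h0 i)) (h0 j)
  simpa [mul_assoc] using this

/-- Products with an element of `B` maximizing `d` show that the maximum of `d` on the triple is
attained twice; likewise the minimum. With three elements, `d` is then constant on the triple. -/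
theorem not_hom (h : NoUniqueProduct s B) (d : G → ℤ) (hd : ∀ g k, d (g * k) = d g + d k)
    (hs : ¬ ∀ i j, d (s i) = d (s j)) : False := by
  obtain ⟨bmax, hbmax, hmax⟩ := B.exists_max_image d h.nonempty
  obtain ⟨bmin, hbmin, hmin⟩ := B.exists_min_image d h.nonempty
  have hM : ∀ i, ∃ j, j ≠ i ∧ d (s i) ≤ d (s j) := by
    intro i
    obtain ⟨j, hj, b', hb', e⟩ := h.exists_eq bmax hbmax i
    have := congrArg d e
    rw [hd, hd] at this
    exact ⟨j, hj, by linarith [hmax b' hb']⟩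
  have hm : ∀ i, ∃ j, j ≠ i ∧ d (s j) ≤ d (s i) := by
    intro i
    obtain ⟨j, hj, b', hb', e⟩ := h.exists_eq bmin hbmin i
    have := congrArg d e
    rw [hd, hd] at this
    exact ⟨j, hj, by linarith [hmin b' hb']⟩
  apply hs
  have M0 := hM 0
  have M1 := hM 1
  have M2 := hM 2
  have m0 := hm 0
  have m1 := hm 1
  have m2 := hm 2
  simp only [Fin.exists_fin_succ, Fin.isValue, IsEmpty.exists_iff, ne_eq] at M0 M1 M2 m0 m1 m2
  simp at M0 M1 M2 m0 m1 m2
  simp only [Fin.forall_fin_succ]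
  simp
  omega

/-- Otherwise `G` is finitely generated, abelian and torsion-free, and such groups have unique
products. -/
theorem not_commute (h : NoUniqueProduct s B)
    (hc : Commute ((s 0)⁻¹ * s 1) ((s 0)⁻¹ * s 2)) : False := by
  have htop : Subgroup.closure {(s 0)⁻¹ * s 1, (s 0)⁻¹ * s 2} = ⊤ :=
    h.eq_top_of_mem (Subgroup.subset_closure (by simp)) (Subgroup.subset_closure (by simp))
  have hcomm : ∀ g k : G, g * k = k * g := by
    have hmem : ∀ g : G, g ∈ Subgroup.closure {(s 0)⁻¹ * s 1, (s 0)⁻¹ * s 2} := by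
      simp [htop]
    have hpair : ∀ a ∈ ({(s 0)⁻¹ * s 1, (s 0)⁻¹ * s 2} : Set G),
        ∀ b ∈ ({(s 0)⁻¹ * s 1, (s 0)⁻¹ * s 2} : Set G), a * b = b * a := by
      rintro a (rfl | rfl) b (rfl | rfl)
      exacts [rfl, hc, hc.symm, rfl]
    intro g k
    have := (Subgroup.isMulCommutative_closure hpair).is_comm.comm
      ⟨g, hmem g⟩ ⟨k, hmem k⟩
    exact congrArg Subtype.val this
  let _ : CommGroup G := { ‹Group G› with mul_comm := hcomm }
  have : IsMulTorsionFree G := .of_not_isOfFinOrder fun a ha hfin => by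
    obtain ⟨n, hn, hna⟩ := isOfFinOrder_iff_pow_eq_one.1 hfin
    exact ha (h.eq_one_of_pow a n hn.ne' hna)
  have : Group.FG G := Group.fg_iff.2 ⟨_, htop, by simp⟩
  have : Monoid.FG G := Group.fg_iff_monoid_fg.1 this
  have hu : UniqueProds G := inferInstance
  classical
  obtain ⟨a, ha, b, hb, hab⟩ := hu.uniqueMul_of_nonempty (A := Finset.univ.image s) (B := B)
    (by simp) h.nonempty
  obtain ⟨i, -, rfl⟩ := Finset.mem_image.1 ha
  obtain ⟨j, hj, b', hb', e⟩ := h.exists_eq b hb i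
  exact hj (h.injective (hab (Finset.mem_image_of_mem s (Finset.mem_univ j)) hb' e.symm).1)

theorem not_commute_of_mem_closure (h : NoUniqueProduct s B) {t u : G} (hc : Commute t u)
    (h₁ : (s 0)⁻¹ * s 1 ∈ Subgroup.closure {t, u})
    (h₂ : (s 0)⁻¹ * s 2 ∈ Subgroup.closure {t, u}) : False := by
  have hpair : ∀ a ∈ ({t, u} : Set G), ∀ b ∈ ({t, u} : Set G), a * b = b * a := by
    rintro a (rfl | rfl) b (rfl | rfl)
    exacts [rfl, hc, hc.symm, rfl]
  have := (Subgroup.isMulCommutative_closure hpair).is_comm.comm ⟨_, h₁⟩ ⟨_, h₂⟩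
  exact h.not_commute (congrArg Subtype.val this)

/-- The elements that a power of `t` conjugates to a power of `u`. -/
def conjPowers (t u : G) (m : ℤ) (htu : t * u * t⁻¹ = u ^ m) : Subgroup G :=
  -- Conjugating further by `t` keeps the result a power of `u`, so two elements can be brought to a
  -- common exponent of `t`.
  have step : ∀ (n i : ℕ) (j : ℤ) (g : G), t ^ i * g * (t ^ i)⁻¹ = u ^ j →
      t ^ (n + i) * g * (t ^ (n + i))⁻¹ = u ^ (m ^ n * j) := by
    intro n i j g hg
    induction n with
    | zero => simpa using hg
    | succ n ih =>
      have e : t ^ (n + 1 + i) * g * (t ^ (n + 1 + i))⁻¹ =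
          t * (t ^ (n + i) * g * (t ^ (n + i))⁻¹) * t⁻¹ := by
        rw [show n + 1 + i = n + i + 1 by ring, pow_succ']
        group
      rw [e, ih, ← conj_zpow, htu, ← zpow_mul, pow_succ']
      ring_nf
  { carrier := {g | ∃ (i : ℕ) (j : ℤ), t ^ i * g * (t ^ i)⁻¹ = u ^ j}
    one_mem' := ⟨0, 0, by simp⟩
    mul_mem' := by
      rintro a b ⟨i, j, ha⟩ ⟨i', j', hb⟩
      refine ⟨i' + i, m ^ i' * j + m ^ i * j', ?_⟩
      have h1 := step i' i j a ha
      have h2 := step i i' j' b hb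
      rw [add_comm i i'] at h2
      rw [zpow_add, ← h1, ← h2]
      group
    inv_mem' := by
      rintro a ⟨i, j, ha⟩
      refine ⟨i, -j, ?_⟩
      rw [zpow_neg, ← ha]
      group }

theorem mem_conjPowers {t u : G} {m : ℤ} {htu : t * u * t⁻¹ = u ^ m} {g : G} :
    g ∈ conjPowers t u m htu ↔ ∃ (i : ℕ) (j : ℤ), t ^ i * g * (t ^ i)⁻¹ = u ^ j :=
  Iff.rfl

theorem conj_mem_conjPowers {t u : G} {m : ℤ} {htu : t * u * t⁻¹ = u ^ m} {g : G}
    (hg : g ∈ conjPowers t u m htu) (k : ℤ) : t ^ k * g * (t ^ k)⁻¹ ∈ conjPowers t u m htu := by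
  have hneg : ∀ (n : ℕ) (g : G), g ∈ conjPowers t u m htu →
      (t ^ n)⁻¹ * g * t ^ n ∈ conjPowers t u m htu := by
    rintro n g ⟨i, j, hg⟩
    refine ⟨i + n, j, ?_⟩
    rw [← hg, pow_add]
    group
  have hone : ∀ g : G, g ∈ conjPowers t u m htu → t * g * t⁻¹ ∈ conjPowers t u m htu := by
    rintro g ⟨i, j, hg⟩
    refine ⟨i, m * j, ?_⟩
    have : t ^ i * (t * g * t⁻¹) * (t ^ i)⁻¹ = t * (t ^ i * g * (t ^ i)⁻¹) * t⁻¹ := by group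
    rw [this, hg, ← conj_zpow, htu, zpow_mul]
  rcases Int.eq_nat_or_neg k with ⟨n, rfl | rfl⟩
  · induction n with
    | zero => simpa using hg
    | succ n ih =>
      have e : t ^ ((n + 1 : ℕ) : ℤ) * g * (t ^ ((n + 1 : ℕ) : ℤ))⁻¹ =
          t * (t ^ (n : ℤ) * g * (t ^ (n : ℤ))⁻¹) * t⁻¹ := by
        push_cast
        group
      rw [e]
      exact hone _ ih
  · have := hneg n g hg
    simpa using this

/-- `G` is the semidirect product of `conjPowers` and the infinite cyclic group generated by `t`.
The exponent of `t` is a homomorphism to `ℤ`, to which `not_hom` applies. -/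
theorem not_conj_eq_zpow (h : NoUniqueProduct s B) {t u : G} {m : ℤ} (hm : m ≠ 1)
    (htu : t * u * t⁻¹ = u ^ m) (h₁ : (s 0)⁻¹ * s 1 ∈ Subgroup.closure {t, u})
    (h₂ : (s 0)⁻¹ * s 2 ∈ Subgroup.closure {t, u}) : False := by
  have hnc : ¬ Commute t u := fun hc => h.not_commute_of_mem_closure hc h₁ h₂
  have ht : t ≠ 1 := fun e => hnc (e ▸ Commute.one_left u)
  have hu : u ≠ 1 := fun e => hnc (e ▸ Commute.one_right t)
  have htop := h.eq_top_of_mem h₁ h₂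
  set N := conjPowers t u m htu with hN
  have hconj : ∀ g ∈ N, ∀ k : ℤ, t ^ k * g * (t ^ k)⁻¹ ∈ N :=
    fun g hg k => conj_mem_conjPowers hg k
  -- Here `t ^ k` is itself a power `u ^ j`, fixed under conjugation by `t`; hence `(m - 1) * j =
  -- 0`, and `m ≠ 1` gives `j = 0`.
  have huniq : ∀ k : ℤ, t ^ k ∈ N → k = 0 := by
    rintro k ⟨i, j, hk⟩
    have e1 : t ^ k = u ^ j := by
      rw [← hk]
      group
    have e2 : u ^ (m * j) = u ^ j := by
      rw [zpow_mul, ← htu, conj_zpow, ← e1]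
      group
    have e3 : u ^ ((m - 1) * j) = 1 := by
      rw [sub_mul, one_mul, zpow_sub, e2, mul_inv_cancel]
    have hj : j = 0 := by
      by_contra hj
      exact hu (h.eq_one_of_zpow (mul_ne_zero (sub_ne_zero.2 hm) hj) e3)
    rw [hj, zpow_zero] at e1
    by_contra hk
    exact ht (h.eq_one_of_zpow hk e1)
  have hmul : ∀ g g' : G, ∀ k k' : ℤ, g * (t ^ k)⁻¹ ∈ N → g' * (t ^ k')⁻¹ ∈ N →
      g * g' * (t ^ (k + k'))⁻¹ ∈ N := by
    intro g g' k k' hg hg'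
    have := N.mul_mem hg (hconj _ hg' k)
    convert this using 1
    group
  have hex : ∀ g : G, ∃ k : ℤ, g * (t ^ k)⁻¹ ∈ N := by
    intro g
    have hg : g ∈ Subgroup.closure {t, u} := by simp [htop]
    induction hg using Subgroup.closure_induction with
    | mem g hg =>
      rcases hg with rfl | rfl
      · exact ⟨1, by simp [N.one_mem]⟩
      · exact ⟨0, mem_conjPowers.2 ⟨0, 1, by simp⟩⟩
    | one => exact ⟨0, by simp [N.one_mem]⟩
    | mul g g' _ _ hg hg' =>
      obtain ⟨k, hk⟩ := hg
      obtain ⟨k', hk'⟩ := hg'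
      exact ⟨k + k', hmul _ _ _ _ hk hk'⟩
    | inv g _ hg =>
      obtain ⟨k, hk⟩ := hg
      refine ⟨-k, ?_⟩
      have := hconj _ (N.inv_mem hk) (-k)
      convert this using 1
      group
  choose d hd using hex
  have hdu : ∀ g k, g * (t ^ k)⁻¹ ∈ N → d g = k := by
    intro g k hk
    have := N.mul_mem (N.inv_mem (hd g)) hk
    have e : (g * (t ^ d g)⁻¹)⁻¹ * (g * (t ^ k)⁻¹) = t ^ (d g - k) := by group
    rw [e] at this
    exact sub_eq_zero.1 (huniq _ this)
  have hdm : ∀ g g', d (g * g') = d g + d g' := fun g g' => hdu _ _ (hmul _ _ _ _ (hd g) (hd g'))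
  refine h.not_hom d hdm fun hs => ?_
  have hd1 : d 1 = 0 := hdu _ _ (by simp [N.one_mem])
  let K : Subgroup G :=
    { carrier := {g | d g = 0}
      one_mem' := hd1
      mul_mem' := fun {a b} (ha : d a = 0) (hb : d b = 0) => by simp [hdm, ha, hb]
      inv_mem' := fun {a} (ha : d a = 0) => by
        have := hdm a a⁻¹
        rw [mul_inv_cancel, hd1, ha, zero_add] at this
        exact this.symm }
  have hK : ∀ i, (s 0)⁻¹ * s i ∈ K := by
    intro i
    have := hdm (s 0) ((s 0)⁻¹ * s i)
    rw [mul_inv_cancel_left, hs i 0] at this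
    change d _ = 0
    linarith
  have ht' : t ∈ K := by
    rw [h.eq_top_of_mem (hK 1) (hK 2)]
    trivial
  have : d t = 1 := hdu _ _ (by simp [N.one_mem])
  have ht'' : d t = 0 := ht'
  omega

end NoUniqueProduct

/-! ### Short relations in torsion-free quotients of the braid group on three strands -/

section Braid

variable {G : Type*} [Group G] {a b : G}

theorem conj_left_of_braid (hab : a * b * a = b * a * b) :
    (a * b * a) * a * (a * b * a)⁻¹ = b := by
  rw [mul_inv_eq_iff_eq_mul]
  calc a * b * a * a = b * a * b * a := by rw [hab]
    _ = b * (a * b * a) := by group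

theorem conj_right_of_braid (hab : a * b * a = b * a * b) :
    (a * b * a) * b * (a * b * a)⁻¹ = a := by
  rw [mul_inv_eq_iff_eq_mul]
  calc a * b * a * b = a * (b * a * b) := by group
    _ = a * (a * b * a) := by rw [← hab]

theorem Commute.of_mul_mul {g x y w : G} (hx : Commute g x) (hy : Commute g y)
    (h : Commute g (x * w * y)) : Commute g w := by
  have : w = x⁻¹ * (x * w * y) * y⁻¹ := by group
  rw [this]
  exact (hx.inv_right.mul_right h).mul_right hy.inv_right

theorem braid_pow_eq (hab : a * b * a = b * a * b) {c : G} {n : ℕ} (hca : Commute c a)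
    (hcb : Commute c b) (h : a ^ n = c) : b ^ n = c := by
  have hc : Commute (a * b * a) c := ((hca.mul_right hcb).mul_right hca).symm
  rw [← conj_left_of_braid hab, conj_pow, h, hc.eq]
  group

/-- Since `a² = b²` is central and `b⁻¹ab = aba⁻¹`, the cube of `ab⁻¹` collapses to `1`. -/
theorem eq_of_braid_of_sq (tf : ∀ (g : G) (n : ℕ), n ≠ 0 → g ^ n = 1 → g = 1)
    (hab : a * b * a = b * a * b) (h : a ^ 2 = b ^ 2) : a = b := by
  have hcb : Commute (a ^ 2) b := h ▸ (Commute.refl b).pow_left 2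
  have h3 : (a * b⁻¹) ^ 3 = 1 := by
    have e1 : b⁻¹ * a * b = a * b * a⁻¹ := by
      rw [eq_mul_inv_iff_mul_eq]
      calc b⁻¹ * a * b * a = b⁻¹ * (a * b * a) := by group
        _ = b⁻¹ * (b * a * b) := by rw [hab]
        _ = a * b := by group
    calc (a * b⁻¹) ^ 3 = a * (b⁻¹ * a * b) * (b ^ 2)⁻¹ * a * b⁻¹ := by
          simp only [pow_succ, pow_zero, one_mul, mul_inv_rev]
          group
      _ = a * (a * b * a⁻¹) * (a ^ 2)⁻¹ * a * b⁻¹ := by rw [e1, ← h]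
      _ = a ^ 2 * b * (a ^ 2)⁻¹ * b⁻¹ := by rw [pow_two]; group
      _ = 1 := by rw [hcb.eq]; group
  exact mul_inv_eq_one.1 (tf _ 3 (by norm_num) h3)

/-- Adding `a³ = 1` to the braid group gives `SL(2,3)`, with quaternion subgroup generated by `i =
b⁻¹a` and `j = ab⁻¹`. With `a³` merely central, `i² = j²` and `(ij)²i² = 1` survive and force `i¹² =
1`. -/
theorem eq_of_braid_of_cube (tf : ∀ (g : G) (n : ℕ), n ≠ 0 → g ^ n = 1 → g = 1)
    (hab : a * b * a = b * a * b) {c : G} (hca : Commute c a) (hcb : Commute c b)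
    (h : a ^ 3 = c) : a = b := by
  have hb3 : b ^ 3 = c := braid_pow_eq hab hca hcb h
  have hib : c * b⁻¹ = b * b := by
    rw [← hb3]
    simp [pow_succ, mul_assoc]
  have hia : c * a⁻¹ = a * a := by
    rw [← h]
    simp [pow_succ, mul_assoc]
  have hci : Commute c (b⁻¹ * a) := hcb.inv_right.mul_right hca
  have hcj : Commute c (a * b⁻¹) := hca.mul_right hcb.inv_right
  have hz1 : c * c * ((b⁻¹ * a) * (b⁻¹ * a)) = (a * b * a) * (a * b * a) := by
    calc c * c * ((b⁻¹ * a) * (b⁻¹ * a)) = c * (c * (b⁻¹ * a)) * (b⁻¹ * a) := by group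
      _ = c * b⁻¹ * a * (c * b⁻¹) * a := by rw [hci.eq]; group
      _ = b * (b * a * b) * (b * a) := by rw [hib]; group
      _ = b * (a * b * a) * (b * a) := by rw [hab]
      _ = (b * a * b) * (a * b * a) := by group
      _ = (a * b * a) * (a * b * a) := by rw [← hab]
  have hz2 : c * c * ((a * b⁻¹) * (a * b⁻¹)) = (a * b * a) * (a * b * a) := by
    calc c * c * ((a * b⁻¹) * (a * b⁻¹)) = c * (c * (a * b⁻¹)) * (a * b⁻¹) := by group
      _ = (c * a) * b⁻¹ * (c * a) * b⁻¹ := by rw [hcj.eq]; group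
      _ = a * (c * b⁻¹) * a * (c * b⁻¹) := by rw [hca.eq]; group
      _ = a * b * (b * a * b) * b := by rw [hib]; group
      _ = a * b * (a * b * a) * b := by rw [hab]
      _ = (a * b * a) * (b * a * b) := by group
      _ = (a * b * a) * (a * b * a) := by rw [← hab]
  obtain ⟨i, hi⟩ : ∃ i, i = b⁻¹ * a := ⟨_, rfl⟩
  obtain ⟨j, hj⟩ : ∃ j, j = a * b⁻¹ := ⟨_, rfl⟩
  have hij : i * i = j * j := by
    rw [hi, hj]
    exact mul_left_cancel (hz1.trans hz2.symm)
  have hprod : i * j = c * (a * b * a)⁻¹ := by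
    calc i * j = b⁻¹ * (a * a) * b⁻¹ := by rw [hi, hj]; group
      _ = (b⁻¹ * c) * a⁻¹ * b⁻¹ := by rw [← hia]; group
      _ = c * (b * a * b)⁻¹ := by rw [← hcb.inv_right.eq]; group
      _ = c * (a * b * a)⁻¹ := by rw [hab]
  have hcd : Commute c (a * b * a) := (hca.mul_right hcb).mul_right hca
  have hfour : i * j * (i * j) * (i * i) = 1 := by
    have hz : (a * b * a) * (a * b * a) = c * c * (i * i) := by rw [← hz1, hi]
    have hii : i * i = c⁻¹ * c⁻¹ * ((a * b * a) * (a * b * a)) := by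
      rw [hz]
      group
    obtain ⟨D, hD⟩ : ∃ D, D = a * b * a := ⟨_, rfl⟩
    rw [← hD] at hcd hprod hii
    have e := (hcd.mul_left hcd).mul_right (hcd.mul_left hcd)
    calc i * j * (i * j) * (i * i) = c * (D⁻¹ * c) * D⁻¹ * (c⁻¹ * c⁻¹ * (D * D)) := by
          rw [hprod, hii]; group
      _ = c * c * ((D * D)⁻¹ * (c * c)⁻¹) * (D * D) := by
          rw [← hcd.inv_right.eq]; group
      _ = 1 := by
          rw [← e.inv_inv.eq]; group
  have h3 : i * j * i = (j * j * j)⁻¹ := by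
    rw [eq_inv_iff_mul_eq_one]
    calc i * j * i * (j * j * j) = i * j * (i * j) * (j * j) := by group
      _ = 1 := by rw [← hij, hfour]
  have h6 : i ^ 12 = 1 := by
    have e1 : (i * j * i) * (i * j * i) = i ^ 6 := by
      calc (i * j * i) * (i * j * i) = i * j * (i * i) * j * i := by group
        _ = i * (j * j) * (j * j) * i := by rw [hij]; group
        _ = i ^ 6 := by rw [← hij]; simp [pow_succ, mul_assoc]
    have e2 : (i * j * i) * (i * j * i) = (i ^ 6)⁻¹ := by
      rw [h3]
      calc (j * j * j)⁻¹ * (j * j * j)⁻¹ = ((j * j) ^ 3)⁻¹ := by simp [pow_succ, mul_assoc]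
        _ = (i ^ 6)⁻¹ := by rw [← hij]; simp [pow_succ, mul_assoc]
    have e3 : i ^ 6 * i ^ 6 = 1 := by
      rw [← eq_inv_iff_mul_eq_one]
      exact e1.symm.trans e2
    rw [← e3]
    group
  have hi1 : i = 1 := tf i 12 (by norm_num) h6
  rw [hi, inv_mul_eq_one] at hi1
  exact hi1.symm

/-- The squares `i = a²` and `j = b²` have the same central square `c`. Torsion-freeness makes
commuting elements with equal squares equal; this is applied to `i` and `jij⁻¹`, then to `i` and
`j`. -/
theorem eq_of_braid_of_fourth (tf : ∀ (g : G) (n : ℕ), n ≠ 0 → g ^ n = 1 → g = 1)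
    (hab : a * b * a = b * a * b) {c : G} (hca : Commute c a) (hcb : Commute c b)
    (h : a ^ 4 = c) : a = b := by
  have hb4 : b ^ 4 = c := braid_pow_eq hab hca hcb h
  obtain ⟨z, hz⟩ : ∃ z, z = (a * b * a) * (a * b * a) := ⟨_, rfl⟩
  have hza : Commute z a := by
    have h1 := conj_left_of_braid hab
    have h2 := conj_right_of_braid hab
    rw [mul_inv_eq_iff_eq_mul] at h1 h2
    rw [hz]
    change _ * _ = _ * _
    rw [mul_assoc, h1, ← mul_assoc, h2, mul_assoc]
  have hzb : Commute z b := by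
    have h1 := conj_left_of_braid hab
    have h2 := conj_right_of_braid hab
    rw [mul_inv_eq_iff_eq_mul] at h1 h2
    rw [hz]
    change _ * _ = _ * _
    rw [mul_assoc, h2, ← mul_assoc, h1, mul_assoc]
  refine eq_of_braid_of_sq tf hab ?_
  obtain ⟨i, hi⟩ : ∃ i, i = a ^ 2 := ⟨_, rfl⟩
  obtain ⟨j, hj⟩ : ∃ j, j = b ^ 2 := ⟨_, rfl⟩
  have hii : i * i = c := by
    rw [← h, hi]
    group
  have hjj : j * j = c := by
    rw [← hb4, hj]
    group
  have hci : Commute c i := hi ▸ hca.pow_right 2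
  have hcj : Commute c j := hj ▸ hcb.pow_right 2
  have hzi : Commute z i := hi ▸ hza.pow_right 2
  have hbib : b * i * b = z * i⁻¹ := by
    have : b * i * b = a⁻¹ * z * a⁻¹ := by
      rw [hz, hi]
      simp [pow_succ, mul_assoc]
    rw [this, ← hza.inv_right.eq, hi]
    simp [pow_succ, mul_assoc]
  -- So `ij` is a central factor times a conjugate of `i`, whose square is `c`; therefore `(ij)²`
  -- commutes with `i`.
  have hij : i * j = z⁻¹ * c * c * (b * i * b⁻¹) := by
    have e1 : b * i * b⁻¹ = z * i⁻¹ * j⁻¹ := by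
      rw [← hbib, hj]
      group
    have e2 : c * c * (i⁻¹ * j⁻¹) = i * j := by
      calc c * c * (i⁻¹ * j⁻¹) = c * (c * i⁻¹) * j⁻¹ := by group
        _ = c * (i⁻¹ * c) * j⁻¹ := by rw [hci.inv_right.eq]
        _ = c * i⁻¹ * (c * j⁻¹) := by group
        _ = (i * i) * i⁻¹ * ((j * j) * j⁻¹) := by rw [hii, hjj]
        _ = i * j := by group
    have hzc : Commute z⁻¹ c := by
      rw [← hii]
      exact (hzi.mul_right hzi).inv_left
    rw [e1, ← e2]
    calc c * c * (i⁻¹ * j⁻¹) = (c * c * z⁻¹) * (z * i⁻¹ * j⁻¹) := by group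
      _ = z⁻¹ * c * c * (z * i⁻¹ * j⁻¹) := by
        rw [← (hzc.mul_right hzc).eq]; simp only [mul_assoc]
  have hbc : Commute (z⁻¹ * c * c) (b * i * b⁻¹) := by
    have hzc : Commute (z⁻¹ * c * c) b := (hzb.inv_left.mul_left hcb).mul_left hcb
    have hzi' : Commute (z⁻¹ * c * c) i := (hzi.inv_left.mul_left hci).mul_left hci
    exact (hzc.mul_right hzi').mul_right hzc.inv_right
  have hsq : Commute i (i * j * (i * j)) := by
    have e : i * j * (i * j) = (z⁻¹ * c * c) * (z⁻¹ * c * c) * c := by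
      have hb : (b * i * b⁻¹) * (b * i * b⁻¹) = c := by
        calc (b * i * b⁻¹) * (b * i * b⁻¹) = b * (i * i) * b⁻¹ := by group
          _ = c * b * b⁻¹ := by rw [hii, hcb.eq]
          _ = c := by group
      rw [hij]
      calc z⁻¹ * c * c * (b * i * b⁻¹) * (z⁻¹ * c * c * (b * i * b⁻¹))
          = z⁻¹ * c * c * ((b * i * b⁻¹) * (z⁻¹ * c * c)) * (b * i * b⁻¹) := by group
        _ = z⁻¹ * c * c * (z⁻¹ * c * c) * ((b * i * b⁻¹) * (b * i * b⁻¹)) := by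
          rw [← hbc.eq]; group
        _ = _ := by rw [hb]
    have hzi' : Commute (z⁻¹ * c * c) i := (hzi.inv_left.mul_left hci).mul_left hci
    rw [e]
    exact ((hzi'.mul_left hzi').mul_left hci).symm
  have hm : Commute i (j * i * j⁻¹) := by
    refine Commute.of_mul_mul (Commute.refl i) hci.symm ?_
    have : i * (j * i * j⁻¹) * c = i * j * (i * j) := by
      rw [← hjj]
      group
    rwa [this]
  have key : ∀ p q : G, Commute p q → p * p = q * q → p = q := by
    intro p q hpq e
    have : (p * q⁻¹) ^ 2 = 1 := by
      rw [hpq.inv_right.mul_pow, pow_two, e]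
      group
    exact mul_inv_eq_one.1 (tf _ 2 (by norm_num) this)
  have hmi : i = j * i * j⁻¹ := by
    refine key _ _ hm ?_
    calc i * i = c * j * j⁻¹ := by rw [hii]; group
      _ = j * (i * i) * j⁻¹ := by rw [hii, hcj.eq]
      _ = (j * i * j⁻¹) * (j * i * j⁻¹) := by group
  have hcomm : Commute i j := by
    change i * j = j * i
    exact eq_mul_inv_iff_mul_eq.1 hmi
  rw [← hi, ← hj]
  exact key i j hcomm (hii.trans hjj.symm)

/-- If a nonempty product of at most four factors `a` and `b⁻¹` is central, then `a` and `b`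
commute. -/
theorem commute_of_braid_word (tf : ∀ (g : G) (n : ℕ), n ≠ 0 → g ^ n = 1 → g = 1)
    (hab : a * b * a = b * a * b) {t : G} (hta : Commute t a) (htb : Commute t b) (c : List Bool)
    (hne : c ≠ []) (hlen : c.length ≤ 4)
    (h : (c.map fun i => cond i b⁻¹ a).prod = t) : Commute a b := by
  have hti : Commute t b⁻¹ := htb.inv_right
  have heq : a = b → Commute a b := fun e => e ▸ Commute.refl a
  have hrot : ∀ p q : G, Commute t p → p * q = t → q * p = t := by
    intro p q hp e
    calc q * p = p⁻¹ * (p * q) * p := by group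
      _ = p⁻¹ * (t * p) := by rw [e]; group
      _ = t := by rw [hp.eq]; group
  -- A central word with a single factor `a` expresses `a` by powers of `b` and a central element;
  -- `hB` is the same for a single `b⁻¹`.
  have hA : ∀ i j : ℕ, b⁻¹ ^ i * a * b⁻¹ ^ j = t → Commute a b := by
    intro i j e
    refine (Commute.of_mul_mul (x := b⁻¹ ^ i) (y := b⁻¹ ^ j) ?_ ?_ (e ▸ htb.symm)).symm
    · exact (Commute.refl b).inv_right.pow_right i
    · exact (Commute.refl b).inv_right.pow_right j
  have hB : ∀ i j : ℕ, a ^ i * b⁻¹ * a ^ j = t → Commute a b := by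
    intro i j e
    refine Commute.inv_right_iff.1
      (Commute.of_mul_mul (x := a ^ i) (y := a ^ j) ?_ ?_ (e ▸ hta.symm))
    · exact (Commute.refl a).pow_right i
    · exact (Commute.refl a).pow_right j
  have hpow : ∀ (x y : G), x * y * x = y * x * y → ∀ t' : G, Commute t' x → Commute t' y →
      ∀ n ∈ [2, 3, 4], x ^ n = t' → x = y := by
    intro x y hxy t' hx hy n hn e
    simp only [List.mem_cons, List.not_mem_nil, or_false] at hn
    rcases hn with rfl | rfl | rfl
    · exact eq_of_braid_of_sq tf hxy (e.trans (braid_pow_eq hxy hx hy e).symm)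
    · exact eq_of_braid_of_cube tf hxy hx hy e
    · exact eq_of_braid_of_fourth tf hxy hx hy e
  have hF : ∀ n ∈ [2, 3, 4], a ^ n = t → Commute a b :=
    fun n hn e => heq (hpow a b hab t hta htb n hn e)
  have hT : ∀ n ∈ [2, 3, 4], b⁻¹ ^ n = t → Commute a b := by
    intro n hn e
    refine heq (hpow b a hab.symm t⁻¹ htb.inv_left hta.inv_left n hn ?_).symm
    rw [← e, inv_pow, inv_inv]
  have hda := conj_left_of_braid hab
  have hdb := conj_right_of_braid hab
  have hdt : Commute (a * b * a) t := ((hta.mul_right htb).mul_right hta).symm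
  have hconj : ∀ d x y : G, d * (x * y) * d⁻¹ = (d * x * d⁻¹) * (d * y * d⁻¹) :=
    fun d x y => by group
  have hconj' : ∀ d x : G, d * x⁻¹ * d⁻¹ = (d * x * d⁻¹)⁻¹ := fun d x => by group
  -- Conjugation by `aba` exchanges `a` and `b` but fixes `t`, and here the exchanged word is the
  -- inverse one. So `t² = 1` and `t = 1`; `hQ` uses the same trick.
  have hS : a * a * (b⁻¹ * b⁻¹) = t → Commute a b := by
    intro e
    have e' : b * b * (a⁻¹ * a⁻¹) = t := by
      calc b * b * (a⁻¹ * a⁻¹)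
          = (a * b * a) * (a * a * (b⁻¹ * b⁻¹)) * (a * b * a)⁻¹ := by
            rw [hconj, hconj, hconj, hconj', hda, hdb]
        _ = t := by rw [e, hdt.eq]; group
    have ht : t ^ 2 = 1 := by
      rw [pow_two]
      nth_rw 1 [← e]
      rw [← e']
      group
    rw [tf t 2 (by norm_num) ht] at e
    refine heq (eq_of_braid_of_sq tf hab ?_)
    rw [pow_two, pow_two]
    calc a * a = a * a * (b⁻¹ * b⁻¹) * (b * b) := by group
      _ = b * b := by rw [e, one_mul]
  have hQ : a * b⁻¹ * (a * b⁻¹) = t → Commute a b := by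
    intro e
    have e' : b * a⁻¹ * (b * a⁻¹) = t := by
      calc b * a⁻¹ * (b * a⁻¹)
          = (a * b * a) * (a * b⁻¹ * (a * b⁻¹)) * (a * b * a)⁻¹ := by
            rw [hconj, hconj, hconj', hda, hdb]
        _ = t := by rw [e, hdt.eq]; group
    have ht : t ^ 2 = 1 := by
      rw [pow_two]
      nth_rw 1 [← e]
      rw [← e']
      group
    rw [tf t 2 (by norm_num) ht, ← pow_two] at e
    exact heq (mul_inv_eq_one.1 (tf _ 2 (by norm_num) e))
  match c, hlen, h with
  | [], _, _ => exact absurd rfl hne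
  | [false], _, h => exact hA 0 0 (by simpa [pow_succ, mul_assoc] using h)
  | [true], _, h => exact hB 0 0 (by simpa [pow_succ, mul_assoc] using h)
  | [false, false], _, h => exact hF 2 (by decide) (by simpa [pow_succ, mul_assoc] using h)
  | [false, true], _, h => exact hA 0 1 (by simpa [pow_succ, mul_assoc] using h)
  | [true, false], _, h => exact hA 1 0 (by simpa [pow_succ, mul_assoc] using h)
  | [true, true], _, h => exact hT 2 (by decide) (by simpa [pow_succ, mul_assoc] using h)
  | [false, false, false], _, h => exact hF 3 (by decide) (by simpa [pow_succ, mul_assoc] using h)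
  | [false, false, true], _, h => exact hB 2 0 (by simpa [pow_succ, mul_assoc] using h)
  | [false, true, false], _, h => exact hB 1 1 (by simpa [pow_succ, mul_assoc] using h)
  | [false, true, true], _, h => exact hA 0 2 (by simpa [pow_succ, mul_assoc] using h)
  | [true, false, false], _, h => exact hB 0 2 (by simpa [pow_succ, mul_assoc] using h)
  | [true, false, true], _, h => exact hA 1 1 (by simpa [pow_succ, mul_assoc] using h)
  | [true, true, false], _, h => exact hA 2 0 (by simpa [pow_succ, mul_assoc] using h)
  | [true, true, true], _, h => exact hT 3 (by decide) (by simpa [pow_succ, mul_assoc] using h)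
  | [false, false, false, false], _, h =>
    exact hF 4 (by decide) (by simpa [pow_succ, mul_assoc] using h)
  | [false, false, false, true], _, h => exact hB 3 0 (by simpa [pow_succ, mul_assoc] using h)
  | [false, false, true, false], _, h => exact hB 2 1 (by simpa [pow_succ, mul_assoc] using h)
  | [false, false, true, true], _, h => exact hS (by simpa [mul_assoc] using h)
  | [false, true, false, false], _, h => exact hB 1 2 (by simpa [pow_succ, mul_assoc] using h)
  | [false, true, false, true], _, h => exact hQ (by simpa [mul_assoc] using h)
  | [false, true, true, false], _, h =>
    have e := hrot (a * b⁻¹ * b⁻¹) a ((hta.mul_right hti).mul_right hti)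
      (by simpa [mul_assoc] using h)
    exact hS (by simpa [mul_assoc] using e)
  | [false, true, true, true], _, h => exact hA 0 3 (by simpa [pow_succ, mul_assoc] using h)
  | [true, false, false, false], _, h => exact hB 0 3 (by simpa [pow_succ, mul_assoc] using h)
  | [true, false, false, true], _, h =>
    have e := hrot (b⁻¹) (a * a * b⁻¹) hti (by simpa [mul_assoc] using h)
    exact hS (by simpa [mul_assoc] using e)
  | [true, false, true, false], _, h =>
    have e := hrot (b⁻¹) (a * b⁻¹ * a) hti (by simpa [mul_assoc] using h)
    exact hQ (by simpa [mul_assoc] using e)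
  | [true, false, true, true], _, h => exact hA 1 2 (by simpa [pow_succ, mul_assoc] using h)
  | [true, true, false, false], _, h =>
    have e := hrot (b⁻¹ * b⁻¹) (a * a) (hti.mul_right hti) (by simpa [mul_assoc] using h)
    exact hS (by simpa [mul_assoc] using e)
  | [true, true, false, true], _, h => exact hA 2 1 (by simpa [pow_succ, mul_assoc] using h)
  | [true, true, true, false], _, h => exact hA 3 0 (by simpa [pow_succ, mul_assoc] using h)
  | [true, true, true, true], _, h =>
    exact hT 4 (by decide) (by simpa [pow_succ, mul_assoc] using h)
  | _ :: _ :: _ :: _ :: _ :: _, hl, _ => exact absurd hl (by simp)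

end Braid

/-! ### Evaluation of words when `x³ = y²` -/

namespace Letter

variable {G : Type*} [Group G]

/-- The value of a letter. -/
def letterVal (x y : G) : Letter → G
  | u => x
  | uInv => x⁻¹
  | v => y

/-- The value of a word. -/
def wordVal (x y : G) (w : List Letter) : G := (w.map (letterVal x y)).prod

/-- The value of a pair `(k, w)`. -/
def val (x y : G) (e : ℤ × List Letter) : G := (x ^ 3) ^ e.1 * wordVal x y e.2

variable {x y : G}

@[simp] theorem wordVal_nil : wordVal x y [] = 1 := rfl

@[simp] theorem wordVal_cons (l : Letter) (w : List Letter) :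
    wordVal x y (l :: w) = letterVal x y l * wordVal x y w := by simp [wordVal]

@[simp] theorem wordVal_append (w w' : List Letter) :
    wordVal x y (w ++ w') = wordVal x y w * wordVal x y w' := by simp [wordVal]

theorem commute_cube_left (k : ℤ) : Commute ((x ^ 3) ^ k) x :=
  ((Commute.refl x).pow_left 3).zpow_left k

theorem commute_cube_right (hxy : x ^ 3 = y ^ 2) (k : ℤ) : Commute ((x ^ 3) ^ k) y := by
  rw [hxy]
  exact ((Commute.refl y).pow_left 2).zpow_left k

theorem commute_cube_letterVal (hxy : x ^ 3 = y ^ 2) (k : ℤ) (l : Letter) :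
    Commute ((x ^ 3) ^ k) (letterVal x y l) := by
  cases l
  · exact commute_cube_left k
  · exact (commute_cube_left k).inv_right
  · exact commute_cube_right hxy k

theorem mul_val (hxy : x ^ 3 = y ^ 2) (l : Letter) (k : ℤ) (w : List Letter) :
    letterVal x y l * val x y (k, w) = (x ^ 3) ^ k * (letterVal x y l * wordVal x y w) := by
  simp only [val]
  rw [← mul_assoc, ← (commute_cube_letterVal hxy k l).eq, mul_assoc]

theorem val_push (hxy : x ^ 3 = y ^ 2) (l : Letter) (e : ℤ × List Letter) :
    val x y (push l e) = letterVal x y l * val x y e := by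
  obtain ⟨k, w⟩ := e
  rw [mul_val hxy]
  match l, w with
  | u, [] | uInv, [] | v, [] => rfl
  | u, v :: w | uInv, v :: w | v, u :: w | v, uInv :: w => simp [push, val]
  | u, u :: w =>
    simp only [push, val, zpow_add, zpow_one, wordVal_cons, letterVal, mul_assoc]
    simp [pow_succ, mul_assoc]
  | u, uInv :: w => simp [push, val, letterVal]
  | uInv, u :: w => simp [push, val, letterVal]
  | uInv, uInv :: w =>
    simp only [push, val, zpow_sub, zpow_one, wordVal_cons, letterVal, mul_assoc]
    simp [pow_succ, mul_assoc]
  | v, v :: w =>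
    simp only [push, val, zpow_add, zpow_one, wordVal_cons, letterVal, mul_assoc]
    rw [mul_right_inj, hxy, pow_two, mul_assoc]

theorem val_pushInv (hxy : x ^ 3 = y ^ 2) (l : Letter) (e : ℤ × List Letter) :
    val x y (pushInv l e) = (letterVal x y l)⁻¹ * val x y e := by
  cases l with
  | u => exact val_push hxy _ _
  | uInv =>
    rw [pushInv, val_push hxy]
    simp [letterVal]
  | v =>
    obtain ⟨k, w⟩ := e
    rw [pushInv, val_push hxy]
    simp only [val, zpow_sub, letterVal, zpow_one]
    rw [((Commute.refl (x ^ 3)).zpow_left k).inv_right.eq, hxy]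
    simp [pow_succ, mul_assoc]

theorem val_pushWord (hxy : x ^ 3 = y ^ 2) (w : List Letter) (e : ℤ × List Letter) :
    val x y (pushWord w e) = wordVal x y w * val x y e := by
  induction w with
  | nil => simp [pushWord]
  | cons l w ih => rw [pushWord, val_push hxy, ih, wordVal_cons, mul_assoc]

theorem val_pushWordInv (hxy : x ^ 3 = y ^ 2) (w : List Letter) (e : ℤ × List Letter) :
    val x y (pushWordInv w e) = (wordVal x y w)⁻¹ * val x y e := by
  induction w generalizing e with
  | nil => simp [pushWordInv]
  | cons l w ih => rw [pushWordInv, ih, val_pushInv hxy, wordVal_cons, mul_inv_rev, mul_assoc]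

theorem splitLast_eq (l : Letter) (w : List Letter) :
    (splitLast l w).1 ++ [(splitLast l w).2] = l :: w := by
  induction w generalizing l with
  | nil => rfl
  | cons m w ih => simp [splitLast, ih]

/-- Moving the last letter to the front is a conjugation. Stopping early for lack of fuel is
harmless. -/
theorem val_cyclicReduce (hxy : x ^ 3 = y ^ 2) (n : ℕ) (e : ℤ × List Letter)
    (he : val x y e = 1) : val x y (cyclicReduce n e) = 1 := by
  induction n generalizing e with
  | zero => exact he
  | succ n ih =>
    match e with
    | (k, []) => exact he
    | (k, [l]) => exact he
    | (k, l :: m :: w) =>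
      rw [cyclicReduce]
      split
      next i t hit =>
        split_ifs with hlt
        · refine ih _ ?_
          have hs := splitLast_eq m w
          rw [hit] at hs
          rw [val_push hxy, mul_eq_one_iff_inv_eq, eq_comm, ← mul_eq_one_iff_eq_inv]
          rw [← he, ← hs]
          simp [val, mul_assoc]
        · exact he

theorem wordVal_syllables (w : List Letter) (c : List Bool) (hc : syllables w = some c) :
    wordVal x y w = (c.map fun i => cond i (x * y) (x⁻¹ * y)).prod := by
  induction w using syllables.induct generalizing c with
  | case1 =>
    simp only [syllables, Option.some.injEq] at hc
    simp [← hc]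
  | case2 w ih =>
    simp only [syllables, Option.map_eq_some_iff] at hc
    obtain ⟨c', hc', rfl⟩ := hc
    simp [ih c' hc', letterVal, mul_assoc]
  | case3 w ih =>
    simp only [syllables, Option.map_eq_some_iff] at hc
    obtain ⟨c', hc', rfl⟩ := hc
    simp [ih c' hc', letterVal, mul_assoc]
  | case4 w h1 h2 h3 => simp [syllables] at hc

/-- The syllable `xy` is the central `x³` times `x⁻²y = (y⁻¹x²)⁻¹`. -/
theorem prod_syllables (hxy : x ^ 3 = y ^ 2) (c : List Bool) :
    ∃ k : ℤ, (c.map fun i => cond i (x * y) (x⁻¹ * y)).prod =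
      (x ^ 3) ^ k * (c.map fun i => cond i (y⁻¹ * x ^ 2)⁻¹ (x⁻¹ * y)).prod := by
  induction c with
  | nil => exact ⟨0, by simp⟩
  | cons i c ih =>
    obtain ⟨k, hk⟩ := ih
    cases i with
    | false =>
      refine ⟨k, ?_⟩
      have h : Commute ((x ^ 3) ^ k) (x⁻¹ * y) :=
        (commute_cube_left k).inv_right.mul_right (commute_cube_right hxy k)
      simp only [List.map_cons, List.prod_cons, hk, cond_false]
      rw [← mul_assoc, ← h.eq, mul_assoc]
    | true =>
      refine ⟨k + 1, ?_⟩
      have h : Commute ((x ^ 3) ^ k) (x * y) :=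
        (commute_cube_left k).mul_right (commute_cube_right hxy k)
      simp only [List.map_cons, List.prod_cons, hk, cond_true]
      rw [← mul_assoc, ← h.eq, mul_assoc, zpow_add, zpow_one]
      simp [pow_succ, mul_assoc]

/-- The elements `a = x⁻¹y` and `b = y⁻¹x²` satisfy the braid relation, both sides being `y`. A
trivial value makes a short product of factors `a` and `b⁻¹` central, so `a` and `b` commute, and
with them `x = ab` and `y`. -/
theorem val_ne_one_of_syllables (tf : ∀ (g : G) (n : ℕ), n ≠ 0 → g ^ n = 1 → g = 1)
    (hxy : x ^ 3 = y ^ 2) (hc : ¬ Commute x y) (k : ℤ) (w : List Letter) (c : List Bool)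
    (hw : syllables w = some c) (hne : c ≠ []) (hlen : c.length ≤ 4) : val x y (k, w) ≠ 1 := by
  intro h
  apply hc
  obtain ⟨m, hm⟩ := prod_syllables hxy c
  simp only [val] at h
  rw [wordVal_syllables w c hw, hm, ← mul_assoc, ← zpow_add, mul_eq_one_iff_inv_eq,
    ← zpow_neg] at h
  have hx := commute_cube_left (x := x) (-(k + m))
  have hy := commute_cube_right hxy (-(k + m))
  have hbraid : (x⁻¹ * y) * (y⁻¹ * x ^ 2) * (x⁻¹ * y) =
      (y⁻¹ * x ^ 2) * (x⁻¹ * y) * (y⁻¹ * x ^ 2) := by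
    have e : y⁻¹ * x ^ 3 = y := by
      rw [hxy, pow_two, inv_mul_cancel_left]
    calc (x⁻¹ * y) * (y⁻¹ * x ^ 2) * (x⁻¹ * y) = y := by simp [pow_succ, mul_assoc]
      _ = y⁻¹ * x ^ 3 := e.symm
      _ = _ := by simp [pow_succ, mul_assoc]
  have key := commute_of_braid_word tf hbraid (hx.inv_right.mul_right hy)
    (hy.inv_right.mul_right (hx.pow_right 2)) c hne hlen h.symm
  have e1 : x = (x⁻¹ * y) * (y⁻¹ * x ^ 2) := by simp [pow_succ, mul_assoc]
  have h1 : Commute (x⁻¹ * y) x := by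
    nth_rw 2 [e1]
    exact (Commute.refl _).mul_right key
  simpa using (Commute.refl x).mul_right h1.symm

theorem val_ne_one_of_nontrivial (tf : ∀ (g : G) (n : ℕ), n ≠ 0 → g ^ n = 1 → g = 1)
    (hxy : x ^ 3 = y ^ 2) (hc : ¬ Commute x y) (e : ℤ × List Letter) (he : nontrivial e = true) :
    val x y e ≠ 1 := by
  have hx : x ≠ 1 := fun h => hc (h ▸ Commute.one_left y)
  have hz : ∀ k : ℤ, k ≠ 0 → (x ^ 3) ^ k ≠ 1 := by
    intro k hk h
    refine hx (tf x (3 * k.natAbs) (by simpa using hk) ?_)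
    rw [pow_mul]
    rcases Int.natAbs_eq k with e | e
    · rwa [e, zpow_natCast] at h
    · rwa [e, zpow_neg, inv_eq_one, zpow_natCast] at h
  have hsyl : ∀ (k : ℤ) (w : List Letter), (match syllables w with
      | some (_ :: c) => decide (c.length ≤ 3)
      | _ => false) = true → val x y (k, w) ≠ 1 := by
    intro k w hw
    split at hw
    · next i c hi =>
      exact val_ne_one_of_syllables tf hxy hc k w _ hi (by simp)
        (by simpa [Nat.lt_succ_iff] using hw)
    · simp at hw
  match e, he with
  | (k, []), he =>
    intro h
    refine hz k (by simpa [nontrivial] using he) ?_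
    simpa [val] using h
  | (k, [l]), _ =>
    intro h
    simp only [val, wordVal_cons, wordVal_nil, mul_one, mul_eq_one_iff_inv_eq, ← zpow_neg] at h
    have hl := commute_cube_left (x := x) (-k)
    have hr := commute_cube_right hxy (-k)
    rw [h] at hl hr
    cases l with
    | u => exact hc hr
    | uInv => exact hc (Commute.inv_left_iff.1 hr)
    | v => exact hc hl.symm
  -- The leading `v` is rotated to the end, so that the word can be read in syllables.
  | (k, v :: m :: w), he =>
    intro h
    refine hsyl k (m :: w ++ [v]) he ?_
    have h' : letterVal x y v * val x y (k, m :: w) = 1 := by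
      rw [mul_val hxy]
      exact h
    have h'' := mul_eq_one_comm.1 h'
    simpa [val, mul_assoc] using h''
  | (k, u :: m :: w), he => exact hsyl k (u :: m :: w) he
  | (k, uInv :: m :: w), he => exact hsyl k (uInv :: m :: w) he

theorem val_ne_of_ne (tf : ∀ (g : G) (n : ℕ), n ≠ 0 → g ^ n = 1 → g = 1)
    (hxy : x ^ 3 = y ^ 2) (hc : ¬ Commute x y) (e f : ℤ × List Letter) (h : ne e f = true) :
    val x y e ≠ val x y f := by
  intro hef
  refine val_ne_one_of_nontrivial tf hxy hc _ h (val_cyclicReduce hxy _ _ ?_)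
  rw [val_pushWordInv hxy]
  simp only [val, zpow_sub] at hef ⊢
  rw [((Commute.refl (x ^ 3)).zpow_zpow e.1 f.1).inv_right.eq, mul_assoc, hef]
  simp

theorem ten_le_card_of_search {s : Fin 3 → G} {B : Finset G} (h : NoUniqueProduct s B)
    (hxy : x ^ 3 = y ^ 2) (hc : ¬ Commute x y) (σ : Fin 3 → List Letter)
    (hσ : ∀ i, (s 0)⁻¹ * s i = wordVal x y (σ i))
    (hs : search (move σ) ne 40 9 [(0, [])] [((0, []), 0), ((0, []), 1), ((0, []), 2)] = true) :
    10 ≤ B.card := by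
  refine card_le_of_search_one h (move σ) ne (val x y) ?_
    (val_ne_of_ne h.eq_one_of_pow hxy hc) (0, []) (by simp [val]) 40 9 hs
  intro i j e
  rw [move, val_pushWordInv hxy, val_pushWord hxy, ← hσ, ← hσ]
  group

end Letter

/-! ### Alternating words in the quotients of three elements -/

namespace PairWord

/-- The pair `(j, i)` stands for `(s j)⁻¹ * s i`, a list of pairs for the product. -/
abbrev Pair := Fin 3 × Fin 3

/-- Equality of indices. -/
def same : Fin 3 → Fin 3 → Bool
  | 0, 0 => true
  | 1, 1 => true
  | 2, 2 => true
  | _, _ => false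

/-- Left multiplication of a word by a pair. -/
def push (p : Pair) : List Pair → List Pair
  | [] => [p]
  | q :: w =>
    if same p.2 q.1 then (if same p.1 q.2 then w else (p.1, q.2) :: w) else p :: q :: w

/-- Left multiplication by the inverse of a word. -/
def pushInv : List Pair → List Pair → List Pair
  | [], e => e
  | p :: w, e => pushInv w (push p.swap e)

/-- Splits off the last pair of a nonempty word. -/
def splitLast : Pair → List Pair → List Pair × Pair
  | l, [] => ([], l)
  | l, m :: w =>
    match splitLast m w with
    | (i, t) => (l :: i, t)

/-- Cyclic reduction. -/
def cyclicReduce : ℕ → List Pair → List Pair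
  | 0, e => e
  | _ + 1, [] => []
  | _ + 1, [l] => [l]
  | n + 1, l :: m :: w =>
    match splitLast m w with
    | (i, t) => if same t.2 l.1 then cyclicReduce n (push t (l :: i)) else l :: m :: w

/-- Whether a word is reduced when followed by the index `a`. -/
def reducedTo (a : Fin 3) : List Pair → Bool
  | [] => true
  | [p] => !same p.1 p.2 && !same p.2 a
  | p :: q :: w => !same p.1 p.2 && !same p.2 q.1 && reducedTo a (q :: w)

/-- Whether a word is cyclically reduced and consists of one to four pairs. -/
def short : List Pair → Bool
  | [] => false
  | p :: w => w.length ≤ 3 && reducedTo p.1 (p :: w)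

/-- A sufficient criterion for two words to have different values, if no short word is trivial. -/
def ne (e f : List Pair) : Bool := short (cyclicReduce 10 (pushInv f e))

/-- This search reduces words as in a free group; its distinctness test is sound once no short word
is trivial. -/
theorem search_pairs : search (fun i j => push (j, i)) ne 20 9 [[]]
    [([], 0), ([], 1), ([], 2)] = true := by
  decide +kernel

/-- The renaming that sends `j` to `0`, `i` to `1` and the remaining index to `2`. -/
def renameIndex (j i k : Fin 3) : Fin 3 :=
  if same k j then 0 else if same k i then 1 else 2

/-- Renames a word such that it begins with `(0, 1)`. -/
def normalize : List Pair → List Pair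
  | [] => []
  | p :: w => (p :: w).map (Prod.map (renameIndex p.1 p.2) (renameIndex p.1 p.2))

/-- The inverse word. -/
def inverse (w : List Pair) : List Pair := (w.map Prod.swap).reverse

/-- Representatives of the short words up to renaming, rotation and inversion. -/
def representatives : List (List Pair) :=
  [[(0, 1)],
   [(0, 1), (0, 1)], [(0, 1), (0, 2)],
   [(0, 1), (0, 1), (0, 1)], [(0, 1), (0, 1), (0, 2)], [(0, 1), (0, 2), (1, 2)],
   [(0, 1), (2, 0), (1, 2)],
   [(0, 1), (0, 1), (0, 1), (0, 1)], [(0, 1), (0, 1), (0, 1), (0, 2)],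
   [(0, 1), (0, 1), (0, 2), (0, 2)], [(0, 1), (0, 1), (2, 0), (1, 2)],
   [(0, 1), (0, 1), (2, 1), (0, 2)], [(0, 1), (0, 2), (0, 1), (0, 2)],
   [(0, 1), (0, 2), (0, 1), (2, 1)], [(0, 1), (0, 2), (1, 0), (2, 1)],
   [(0, 1), (0, 1), (2, 0), (2, 1)], [(0, 1), (0, 2), (1, 0), (1, 2)]]

/-- Whether a rotation of a word or of its inverse renames to a representative. -/
def classified (w : List Pair) : Bool :=
  [0, 1, 2, 3].any fun n => representatives.contains (normalize (w.rotate n)) ||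
    representatives.contains (normalize ((inverse w).rotate n))

theorem classified_of_short (w : List Pair) (hw : short w = true) : classified w = true := by
  have h1 : ∀ a b : Fin 3, short [(a, b)] = true → classified [(a, b)] = true := by
    decide +kernel
  have h2 : ∀ a b c d : Fin 3, short [(a, b), (c, d)] = true →
      classified [(a, b), (c, d)] = true := by
    decide +kernel
  have h3 : ∀ a b c d e f : Fin 3, short [(a, b), (c, d), (e, f)] = true →
      classified [(a, b), (c, d), (e, f)] = true := by
    decide +kernel
  have h4 : ∀ a b c d e f g h : Fin 3, short [(a, b), (c, d), (e, f), (g, h)] = true →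
      classified [(a, b), (c, d), (e, f), (g, h)] = true := by
    decide +kernel
  match w, hw with
  | [_], hw => exact h1 _ _ hw
  | [_, _], hw => exact h2 _ _ _ _ hw
  | [_, _, _], hw => exact h3 _ _ _ _ _ _ hw
  | [_, _, _, _], hw => exact h4 _ _ _ _ _ _ _ _ hw
  | _ :: _ :: _ :: _ :: _ :: _, hw =>
    simp only [short, List.length_cons, Bool.and_eq_true, decide_eq_true_eq] at hw
    omega

variable {G : Type*} [Group G]

/-- The value of a word. -/
def val (s : Fin 3 → G) (w : List Pair) : G := (w.map fun p => (s p.1)⁻¹ * s p.2).prod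

variable {s : Fin 3 → G} {B : Finset G}

@[simp] theorem val_nil : val s [] = 1 := rfl

@[simp] theorem val_cons (p : Pair) (w : List Pair) :
    val s (p :: w) = (s p.1)⁻¹ * s p.2 * val s w := by simp [val]

@[simp] theorem val_append (w w' : List Pair) : val s (w ++ w') = val s w * val s w' := by
  simp [val]

theorem eq_of_same : ∀ {i j : Fin 3}, same i j = true → i = j := by decide

theorem val_push (p : Pair) (e : List Pair) :
    val s (push p e) = (s p.1)⁻¹ * s p.2 * val s e := by
  match e with
  | [] => simp [push]
  | q :: w =>
    rw [push]
    split_ifs with h1 h2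
    · simp [eq_of_same h1, eq_of_same h2, mul_assoc]
    · simp [eq_of_same h1, mul_assoc]
    · simp

theorem val_pushInv (f e : List Pair) : val s (pushInv f e) = (val s f)⁻¹ * val s e := by
  induction f generalizing e with
  | nil => simp [pushInv]
  | cons p w ih => simp [pushInv, ih, val_push, mul_assoc]

theorem splitLast_eq (l : Pair) (w : List Pair) :
    (splitLast l w).1 ++ [(splitLast l w).2] = l :: w := by
  induction w generalizing l with
  | nil => rfl
  | cons m w ih => simp [splitLast, ih]

theorem val_cyclicReduce (n : ℕ) (e : List Pair) (he : val s e = 1) :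
    val s (cyclicReduce n e) = 1 := by
  induction n generalizing e with
  | zero => exact he
  | succ n ih =>
    match e with
    | [] => exact he
    | [l] => exact he
    | l :: m :: w =>
      rw [cyclicReduce]
      split
      next i t hit =>
        split_ifs with hlt
        · refine ih _ ?_
          have hs := splitLast_eq m w
          rw [hit] at hs
          rw [val_push, mul_eq_one_comm, ← he, ← hs]
          simp [mul_assoc]
        · exact he

theorem val_inverse (w : List Pair) : val s (inverse w) = (val s w)⁻¹ := by
  induction w with
  | nil => simp [inverse]
  | cons p w ih =>
    have : inverse (p :: w) = inverse w ++ [p.swap] := by simp [inverse]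
    rw [this, val_append, ih]
    simp [mul_assoc]

theorem val_rotate (w : List Pair) (n : ℕ) (hw : val s w = 1) : val s (w.rotate n) = 1 := by
  induction n with
  | zero => simpa using hw
  | succ n ih =>
    rw [← List.rotate_rotate]
    match hn : w.rotate n with
    | [] => simp
    | p :: t =>
      rw [hn, val_cons, mul_eq_one_comm] at ih
      simpa using ih

end PairWord

/-! ### The short relations, case by case -/

namespace NoUniqueProduct

variable {G : Type*} [Group G] {s : Fin 3 → G} {B : Finset G}

theorem ten_le_card_of_cube_eq_sq (h : NoUniqueProduct s B)
    (e : ((s 0)⁻¹ * s 1) ^ 3 = ((s 0)⁻¹ * s 2) ^ 2) : 10 ≤ B.card := by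
  refine Letter.ten_le_card_of_search h e h.not_commute Letter.tripleA ?_ Letter.search_tripleA
  intro i
  fin_cases i <;> simp [Letter.tripleA, Letter.letterVal]

/-- With `u = x` and `v = xy` the relation becomes `u³ = v²`, and `y = u⁻¹v` gives `tripleB`. -/
theorem ten_le_card_of_sq_eq (h : NoUniqueProduct s B)
    (e : ((s 0)⁻¹ * s 2) * ((s 0)⁻¹ * s 1) * ((s 0)⁻¹ * s 2) = ((s 0)⁻¹ * s 1) ^ 2) :
    10 ≤ B.card := by
  obtain ⟨x, hx⟩ : ∃ x, x = (s 0)⁻¹ * s 1 := ⟨_, rfl⟩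
  obtain ⟨y, hy⟩ : ∃ y, y = (s 0)⁻¹ * s 2 := ⟨_, rfl⟩
  have hc := h.not_commute
  rw [← hx, ← hy] at hc
  rw [← hx, ← hy] at e
  refine Letter.ten_le_card_of_search (x := x) (y := x * y) h ?_ ?_ Letter.tripleB ?_
    Letter.search_tripleB
  · calc x ^ 3 = x * x ^ 2 := pow_succ' x 2
      _ = (x * y) ^ 2 := by rw [← e]; simp [pow_succ, mul_assoc]
  · intro hxy
    exact hc (by simpa using (Commute.refl x).inv_right.mul_right hxy)
  · intro i
    fin_cases i
    · simp [Letter.tripleB]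
    · simp [Letter.tripleB, Letter.letterVal, hx]
    · simp [Letter.tripleB, Letter.letterVal, hy]

theorem ten_le_card_of_representative (h : NoUniqueProduct s B) (w : List PairWord.Pair)
    (hw : w ∈ PairWord.representatives) (h1 : PairWord.val s w = 1) : 10 ≤ B.card := by
  obtain ⟨x, hx⟩ : ∃ x, x = (s 0)⁻¹ * s 1 := ⟨_, rfl⟩
  obtain ⟨y, hy⟩ : ∃ y, y = (s 0)⁻¹ * s 2 := ⟨_, rfl⟩
  have h01 : (s 0)⁻¹ * s 1 = x := hx.symm
  have h02 : (s 0)⁻¹ * s 2 = y := hy.symm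
  have h10 : (s 1)⁻¹ * s 0 = x⁻¹ := by rw [hx]; group
  have h20 : (s 2)⁻¹ * s 0 = y⁻¹ := by rw [hy]; group
  have h12 : (s 1)⁻¹ * s 2 = x⁻¹ * y := by rw [hx, hy]; group
  have h21 : (s 2)⁻¹ * s 1 = y⁻¹ * x := by rw [hx, hy]; group
  have hx1 : x ≠ 1 := by
    intro e
    rw [hx, inv_mul_eq_one] at e
    exact absurd (h.injective e) (by decide)
  have hcomm : ¬ Commute x y := by
    rw [hx, hy]
    exact h.not_commute
  have hzpow : ∀ (t u : G) (m : ℤ), m ≠ 1 → t * u * t⁻¹ = u ^ m →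
      x ∈ Subgroup.closure {t, u} → y ∈ Subgroup.closure {t, u} → 10 ≤ B.card := by
    intro t u m hm htu hxm hym
    exact (h.not_conj_eq_zpow hm htu (hx ▸ hxm) (hy ▸ hym)).elim
  have hmem : ∀ t u : G, t ∈ Subgroup.closure {t, u} ∧ u ∈ Subgroup.closure {t, u} :=
    fun t u => ⟨Subgroup.subset_closure (by simp), Subgroup.subset_closure (by simp)⟩
  have hmem' : ∀ t u : G, t ∈ Subgroup.closure {t⁻¹, u} :=
    fun t u => by simpa using Subgroup.inv_mem _ (hmem t⁻¹ u).1
  have hpow : ∀ n : ℕ, n ≠ 0 → x ^ n = 1 → 10 ≤ B.card :=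
    fun n hn e => absurd (h.eq_one_of_pow x n hn e) hx1
  have hxy : ∀ n : ℕ, x ^ n * y = 1 → 10 ≤ B.card := by
    intro n e
    refine absurd ?_ hcomm
    rw [eq_inv_of_mul_eq_one_right e]
    exact ((Commute.refl x).pow_right n).inv_right
  simp only [PairWord.representatives, List.mem_cons, List.not_mem_nil, or_false] at hw
  rcases hw with rfl | rfl | rfl | rfl | rfl | rfl | rfl | rfl | rfl | rfl | rfl | rfl | rfl |
    rfl | rfl | rfl | rfl <;>
    simp only [PairWord.val_cons, PairWord.val_nil, h01, h02, h10, h20, h12, h21, mul_one] at h1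
  · exact hpow 1 (by norm_num) (by simpa using h1)
  · exact hpow 2 (by norm_num) (by simpa [pow_succ] using h1)
  · exact hxy 1 (by simpa using h1)
  · exact hpow 3 (by norm_num) (by simpa [pow_succ, mul_assoc] using h1)
  · exact hxy 2 (by simpa [pow_succ, mul_assoc] using h1)
  · refine hzpow x y (-1) (by norm_num) ?_ (hmem x y).1 (hmem x y).2
    rw [zpow_neg_one]
    exact eq_inv_of_mul_eq_one_left (by simpa [mul_assoc] using h1)
  · refine absurd ?_ hcomm
    have : x * y⁻¹ = y⁻¹ * x := by
      rw [← mul_assoc, mul_eq_one_iff_eq_inv] at h1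
      rw [h1]
      group
    exact Commute.inv_right_iff.1 this
  · exact hpow 4 (by norm_num) (by simpa [pow_succ, mul_assoc] using h1)
  · exact hxy 3 (by simpa [pow_succ, mul_assoc] using h1)
  -- The relation `x²y² = 1` is that of the Klein bottle: `x` inverts `xy`.
  · refine hzpow x (x * y) (-1) (by norm_num) ?_ (hmem _ _).1 ?_
    · rw [zpow_neg_one]
      have e : x * (x * y) = y⁻¹ := eq_inv_of_mul_eq_one_left (by simpa [mul_assoc] using h1)
      rw [e]
      group
    · have := Subgroup.mul_mem _ (Subgroup.inv_mem _ (hmem x (x * y)).1) (hmem x (x * y)).2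
      simpa using this
  · refine hzpow y⁻¹ x 2 (by norm_num) ?_ (hmem _ _).2 (hmem' _ _)
    have e : x * x = (y⁻¹ * (x⁻¹ * y))⁻¹ :=
      eq_inv_of_mul_eq_one_left (by simpa [mul_assoc] using h1)
    rw [zpow_two, e]
    group
  · refine hzpow y⁻¹ x (-2) (by norm_num) ?_ (hmem _ _).2 (hmem' _ _)
    have e : x * x = (y⁻¹ * x * y)⁻¹ :=
      eq_inv_of_mul_eq_one_left (by simpa [mul_assoc] using h1)
    rw [zpow_neg, zpow_two, e]
    group
  · have e : (x * y) ^ 2 = 1 := by simpa [pow_succ, mul_assoc] using h1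
    exact hxy 1 (by simpa using h.eq_one_of_pow _ 2 (by norm_num) e)
  · refine hzpow y x (-2) (by norm_num) ?_ (hmem _ _).2 (hmem _ _).1
    have e : x * (y * x * y⁻¹ * x) = 1 := by simpa [mul_assoc] using h1
    rw [mul_eq_one_comm, mul_assoc] at e
    rw [zpow_neg, zpow_two]
    exact eq_inv_of_mul_eq_one_left e
  · refine hzpow y x 2 (by norm_num) ?_ (hmem _ _).2 (hmem _ _).1
    have e : x * (y * x⁻¹ * y⁻¹ * x) = 1 := by simpa [mul_assoc] using h1
    rw [mul_eq_one_comm, mul_assoc] at e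
    rw [zpow_two, eq_inv_of_mul_eq_one_right e]
    group
  -- The last two relations lead to no contradiction here and need the braid group search.
  · refine h.ten_le_card_of_cube_eq_sq ?_
    rw [h01, h02]
    have e : x * x * ((y * y)⁻¹ * x) = 1 := by simpa [mul_assoc] using h1
    rw [mul_eq_one_comm, mul_assoc, inv_mul_eq_one] at e
    rw [pow_two y, e, pow_succ', pow_two]
  · refine h.ten_le_card_of_sq_eq ?_
    rw [h01, h02]
    have e : x * y * ((x * x)⁻¹ * y) = 1 := by simpa [mul_assoc] using h1
    rw [mul_eq_one_comm, mul_assoc, inv_mul_eq_one] at e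
    rw [pow_two, e, mul_assoc]

/-- Renaming indices amounts to permuting the triple, which preserves the hypotheses and the value
of the word. -/
theorem ten_le_card_of_normalize (h : NoUniqueProduct s B) (w : List PairWord.Pair)
    (hw : PairWord.normalize w ∈ PairWord.representatives) (h1 : PairWord.val s w = 1) :
    10 ≤ B.card := by
  have hhead : ∀ w ∈ PairWord.representatives, w.head? = some (0, 1) := by decide
  match w with
  | [] => exact absurd (hhead _ hw) (by decide)
  | (j, i) :: w =>
    have hji : j ≠ i := by
      rintro rfl
      have := hhead _ hw
      simp only [PairWord.normalize, List.map_cons, List.head?_cons, Prod.map, Option.some.injEq,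
        Prod.mk.injEq] at this
      exact absurd (this.1.symm.trans this.2) (by decide)
    have hinj : ∀ j i : Fin 3, j ≠ i → Function.Injective (PairWord.renameIndex j i) := by decide
    let P : Equiv.Perm (Fin 3) :=
      Equiv.ofBijective _ (Finite.injective_iff_bijective.1 (hinj j i hji))
    refine (h.perm P.symm).ten_le_card_of_representative _ hw ?_
    rw [← h1, PairWord.normalize, PairWord.val, PairWord.val, List.map_map]
    congr 2
    funext p
    have hP : ∀ k, P.symm (PairWord.renameIndex j i k) = k := fun k => P.symm_apply_apply k
    simp [hP]

theorem ten_le_card (h : NoUniqueProduct s B) : 10 ≤ B.card := by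
  by_contra hlt
  have hshort : ∀ w, PairWord.short w = true → PairWord.val s w ≠ 1 := by
    intro w hw h1
    have hc := PairWord.classified_of_short w hw
    simp only [PairWord.classified, List.any_eq_true, Bool.or_eq_true,
      List.contains_iff_mem] at hc
    obtain ⟨n, -, hn | hn⟩ := hc
    · exact hlt (h.ten_le_card_of_normalize _ hn (PairWord.val_rotate w n h1))
    · refine hlt (h.ten_le_card_of_normalize _ hn (PairWord.val_rotate _ n ?_))
      rw [PairWord.val_inverse, h1, inv_one]
  refine hlt (card_le_of_search_one h _ PairWord.ne (PairWord.val s) ?_ ?_ [] rfl 20 9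
    PairWord.search_pairs)
  · intro i j e
    exact PairWord.val_push _ _
  · intro e f hef heq
    refine hshort _ hef (PairWord.val_cyclicReduce _ _ ?_)
    rw [PairWord.val_pushInv, heq, inv_mul_cancel]

/-- Nonunique products with three elements, by passing to the subgroup generated by the quotients
`(s i)⁻¹ * s j`. -/
theorem ten_le_card_of_exists_eq {s : Fin 3 → G} {B : Finset G}
    (tf : ∀ (g : G) (n : ℕ), n ≠ 0 → g ^ n = 1 → g = 1) (hs : Function.Injective s)
    (hB : B.Nonempty)
    (h : ∀ b ∈ B, ∀ i, ∃ j, j ≠ i ∧ ∃ b' ∈ B, s i * b = s j * b') : 10 ≤ B.card := by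
  classical
  obtain ⟨b₀, hb₀⟩ := hB
  set H := Subgroup.closure {g | ∃ i j, g = (s i)⁻¹ * s j} with hH
  have hmem : ∀ i j, (s i)⁻¹ * s j ∈ H := fun i j => Subgroup.subset_closure ⟨i, j, rfl⟩
  let s' : Fin 3 → H := fun i => ⟨(s 0)⁻¹ * s i, hmem 0 i⟩
  have hinj : Function.Injective fun g : H => (g : G) * b₀ :=
    (mul_left_injective b₀).comp Subtype.val_injective
  -- This is the part of `B` in the coset `H * b₀`, translated to contain `1`. Partners of its
  -- elements stay in that coset.
  let B' : Finset H := B.preimage (fun g : H => (g : G) * b₀) hinj.injOn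
  have hB' : ∀ g : H, g ∈ B' ↔ (g : G) * b₀ ∈ B := fun g => Finset.mem_preimage
  have main : NoUniqueProduct s' B' :=
    { eq_one_of_pow := fun g n hn hg =>
        Subtype.ext (tf g n hn (by simpa using congrArg Subtype.val hg))
      injective := fun i j hij => hs (mul_left_cancel (congrArg Subtype.val hij))
      nonempty := ⟨1, (hB' 1).2 (by simpa using hb₀)⟩
      exists_eq := by
        intro b hb i
        obtain ⟨j, hj, b', hb', e⟩ := h _ ((hB' b).1 hb) i
        have e' : b' * b₀⁻¹ = (s j)⁻¹ * s i * b := by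
          rw [mul_inv_eq_iff_eq_mul, mul_assoc, mul_assoc, e, inv_mul_cancel_left]
        refine ⟨j, hj, ⟨b' * b₀⁻¹, e' ▸ H.mul_mem (hmem j i) b.2⟩, (hB' _).2 (by simpa), ?_⟩
        apply Subtype.ext
        simp [s', e', mul_assoc]
      closure_eq_top := by
        rw [← Subgroup.closure_closure_coe_preimage (k := {g | ∃ i j, g = (s i)⁻¹ * s j})]
        congr 1
        ext g
        simp only [Set.mem_ofPred_eq, Set.mem_preimage, s']
        refine exists_congr fun i => exists_congr fun j => ?_
        rw [← Subtype.coe_inj]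
        simp [mul_assoc] }
  refine main.ten_le_card.trans ?_
  exact Finset.card_le_card_of_injOn _ (fun g hg => (hB' g).1 hg) hinj.injOn

end NoUniqueProduct

/-! ### From zero divisors to nonunique products -/

theorem mainTheorem2 {F : Type*} [Field F] {G : Type*} [Group G]
    (hG : ∀ g : G, g ≠ 1 → ¬ IsOfFinOrder g)
    (α β : MonoidAlgebra F G) (hα : α ≠ 0) (hβ : β ≠ 0)
    (hsupp : α.coeff.support.card = 3) (hαβ : α * β = 0) :
    10 ≤ β.coeff.support.card := by
  let e := (α.coeff.support.equivFinOfCardEq hsupp).symm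
  refine NoUniqueProduct.ten_le_card_of_exists_eq (s := fun i => (e i : G)) ?_
    (Subtype.val_injective.comp e.injective) ?_ ?_
  · intro g n hn hg
    by_contra hne
    exact hG g hne (isOfFinOrder_iff_pow_eq_one.2 ⟨n, Nat.pos_of_ne_zero hn, hg⟩)
  · rw [Finsupp.support_nonempty_iff]
    exact fun h => hβ (MonoidAlgebra.coeff_eq_zero.1 h)
  · intro b hb i
    by_contra hcon
    push Not at hcon
    -- A product without partner would have as coefficient in `α * β` a product of two nonzero
    -- scalars.
    have huniq : UniqueMul α.coeff.support β.coeff.support (e i : G) b := by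
      intro a b' ha hb' hab
      obtain ⟨j, hj⟩ := e.surjective ⟨a, ha⟩
      have haj : (e j : G) = a := congrArg Subtype.val hj
      by_cases hji : j = i
      · subst hji
        rw [← haj] at hab ⊢
        exact ⟨rfl, mul_left_cancel hab⟩
      · exact absurd (haj ▸ hab).symm (hcon j hji b' hb')
    have hcoeff := MonoidAlgebra.coeff_mul_mul_of_uniqueMul huniq
    rw [hαβ, MonoidAlgebra.coeff_zero, Finsupp.zero_apply] at hcoeff
    exact mul_ne_zero (Finsupp.mem_support_iff.1 (e i).2) (Finsupp.mem_support_iff.1 hb)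
      hcoeff.symm
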